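/- Theorem 1 (Pointwise LDP for the Nadaraya–Watson estimator). Let $d,q\ge 1$ and let $(X_i,Y_i)_{i\ge1}$ be independent and identically distributed $\mathbb{R}^d\times\mathbb{R}^q$-valued random variables with probability density $f(x,y)$ and $\mathbb{E}\|Y_1\|<\infty$. Let $K:\mathbb{R}^d\to\mathbb{R}$, let $(h_n)$ be a sequence of positive numbers with $h_n\to0$ and $nh_n^d\to\infty$, and fix $x\in\mathbb{R}^d$. Put $$m_n(x)=\frac1{nh_n^d}\sum_{i=1}^nY_iK\Big(\frac{x-X_i}{h_n}\Big),\qquad g_n(x)=\frac1{nh_n^d}\sum_{i=1}^nK\Big(\frac{x-X_i}{h_n}\Big),$$ and $r_n(x)=m_n(x)/g_n(x)$ if $g_n(x)\ne0$, $r_n(x)=0$ otherwise. For $(u,v),(t_1,t_2)\in\mathbb{R}^q\times\mathbb{R}$ and $s\in\mathbb{R}^q$ put $$\Psi_x(u,v)=\int_{\mathbb{R}^d\times\mathbb{R}^q}\big(e^{(\langle u,y\rangle+v)K(z)}-1\big)f(x,y)\,dz\,dy,$$ $$I_x(t_1,t_2)=\sup_{(u,v)\in\mathbb{R}^q\times\mathbb{R}}\{\langle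 u,t_1\rangle+vt_2-\Psi_x(u,v)\},$$ $$J^*(s)=\inf_{t\ne0}I_x(st,t),\qquad J(s)=\inf_{t\in\mathbb{R}}I_x(st,t).$$ Assume: (A1) $K$ is bounded and integrable, $\int_{\mathbb{R}^d}K(z)\,dz=1$, and $K(z)\to0$ as $\|z\|\to\infty$. (A2) For every $u\in\mathbb{R}^q$, the function $t\mapsto\int_{\mathbb{R}^q}e^{\langle u,y\rangle}f(t,y)\,dy$ is bounded on $\mathbb{R}^d$ (in particular finite everywhere) and continuous at $x$. (C) $\inf_{s\in\mathbb{R}^q}I_x(s,0)=I_x(\vec 0,0)$. Then, with $\log 0=-\infty$ and $\inf\emptyset=+\infty$, for every open $U\subset\mathbb{R}^q$, $$\liminf_{n\to\infty}\frac1{nh_n^d}\log\mathbb{P}[r_n(x)\in U]\ge-\inf_{s\in U}J^*(s),$$ and for every closed $V\subset\mathbb{R}^q$, $$\limsup_{n\to\infty}\frac1{nh_n^d}\log\mathbb{P}[r_n(x)\in V]\le-\inf_{s\in V}J(s).$$ -/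

import Mathlib

open MeasureTheory ProbabilityTheory Filter Topology

noncomputable section

namespace NadarayaWatson

/-- `ℝ^k` with its Euclidean norm, scalar product and Lebesgue measure. -/
abbrev E (k : ℕ) : Type := EuclideanSpace ℝ (Fin k)

variable {Ω : Type*} {d q : ℕ}

/-! ### The estimator -/

/-- `m_n(x) = (n h_n^d)⁻¹ ∑ Y_i K((x - X_i) / h_n)`, the sum being over the first `n` observations
(which are numbered from `0` to `n - 1`). -/
def mEst (K : E d → ℝ) (h : ℕ → ℝ) (X : ℕ → Ω → E d) (Y : ℕ → Ω → E q) (x : E d)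
    (n : ℕ) (ω : Ω) : E q :=
  ((n : ℝ) * h n ^ d)⁻¹ • ∑ i ∈ Finset.range n, K ((h n)⁻¹ • (x - X i ω)) • Y i ω

/-- `g_n(x) = (n h_n^d)⁻¹ ∑ K((x - X_i) / h_n)`. -/
def gEst (K : E d → ℝ) (h : ℕ → ℝ) (X : ℕ → Ω → E d) (x : E d) (n : ℕ) (ω : Ω) : ℝ :=
  ((n : ℝ) * h n ^ d)⁻¹ * ∑ i ∈ Finset.range n, K ((h n)⁻¹ • (x - X i ω))

/-- The Nadaraya-Watson estimator `r_n(x)`: `m_n(x) / g_n(x)` if `g_n(x) ≠ 0`, else `0`. -/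
def rEst (K : E d → ℝ) (h : ℕ → ℝ) (X : ℕ → Ω → E d) (Y : ℕ → Ω → E q) (x : E d)
    (n : ℕ) (ω : Ω) : E q :=
  if gEst K h X x n ω ≠ 0 then (gEst K h X x n ω)⁻¹ • mEst K h X Y x n ω else 0

/-! ### The rate functions -/

/-- `Ψ_x(u,v) = ∫ (e^{(⟨u,y⟩ + v) K(z)} - 1) f(x,y) dz dy`, over `(z,y)` in `ℝ^d × ℝ^q`. -/
def Psi (K : E d → ℝ) (f : E d → E q → ℝ) (x : E d) (u : E q) (v : ℝ) : ℝ :=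
  ∫ p : E d × E q, (Real.exp ((inner ℝ u p.2 + v) * K p.1) - 1) * f x p.2

/-- `I_x`, the Fenchel-Legendre transform of `Ψ_x`, with values in the extended reals. -/
def rateI (K : E d → ℝ) (f : E d → E q → ℝ) (x : E d) (t₁ : E q) (t₂ : ℝ) : EReal :=
  ⨆ (u : E q) (v : ℝ), ((inner ℝ u t₁ + v * t₂ - Psi K f x u v : ℝ) : EReal)

/-- `J^*(s) = inf_{t ≠ 0} I_x(s t, t)`. -/
def rateJStar (K : E d → ℝ) (f : E d → E q → ℝ) (x : E d) (s : E q) : EReal :=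
  ⨅ (t : ℝ) (_ : t ≠ 0), rateI K f x (t • s) t

/-- `J(s) = inf_t I_x(s t, t)`. -/
def rateJ (K : E d → ℝ) (f : E d → E q → ℝ) (x : E d) (s : E q) : EReal :=
  ⨅ t : ℝ, rateI K f x (t • s) t

/-! ### The assumptions -/

/-- (A1): `K` is bounded and integrable, has integral `1`, and tends to `0` at infinity. -/
structure CondA1 (K : E d → ℝ) : Prop where
  bounded : ∃ C : ℝ, ∀ z, |K z| ≤ C
  integrable : Integrable K
  integral_eq_one : ∫ z, K z = 1
  tendsto_zero : Tendsto K (cocompact (E d)) (𝓝 0)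

/-- (A2): for every `u`, the function `t ↦ ∫ e^{⟨u,y⟩} f(t,y) dy` is (finite and) bounded, and
continuous at `x`. -/
structure CondA2 (f : E d → E q → ℝ) (x : E d) : Prop where
  integrable : ∀ (u : E q) (t : E d), Integrable fun y => Real.exp (inner ℝ u y) * f t y
  bounded : ∀ u : E q, ∃ C : ℝ, ∀ t : E d, |∫ y, Real.exp (inner ℝ u y) * f t y| ≤ C
  continuousAt : ∀ u : E q, ContinuousAt (fun t : E d => ∫ y, Real.exp (inner ℝ u y) * f t y) x

/-- (C): `inf_s I_x(s, 0) = I_x(0, 0)`. -/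
def CondC (K : E d → ℝ) (f : E d → E q → ℝ) (x : E d) : Prop :=
  ⨅ s : E q, rateI K f x s 0 = rateI K f x 0 0

/-- `(X_i, Y_i)` are independent `ℝ^d × ℝ^q`-valued random variables, each with probability
density `f`, and the `Y_i` have a finite first moment. -/
structure IsSample [MeasurableSpace Ω] (P : Measure Ω) (X : ℕ → Ω → E d) (Y : ℕ → Ω → E q)
    (f : E d → E q → ℝ) : Prop where
  measurable_X : ∀ i, Measurable (X i)
  measurable_Y : ∀ i, Measurable (Y i)
  indep : iIndepFun (fun i ω => (X i ω, Y i ω)) P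
  density_measurable : Measurable fun p : E d × E q => f p.1 p.2
  density_nonneg : ∀ t y, 0 ≤ f t y
  law : ∀ i, P.map (fun ω => (X i ω, Y i ω)) =
    (volume : Measure (E d × E q)).withDensity fun p => ENNReal.ofReal (f p.1 p.2)
  integrable_Y : ∀ i, Integrable (Y i) P

/-- `(n h_n^d)⁻¹ log P[r_n(x) ∈ A]`, with `log 0 = -∞`. -/
def scaledLogProb [MeasurableSpace Ω] (P : Measure Ω) (K : E d → ℝ) (h : ℕ → ℝ)
    (X : ℕ → Ω → E d) (Y : ℕ → Ω → E q) (x : E d) (A : Set (E q)) (n : ℕ) : EReal :=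
  ((((n : ℝ) * h n ^ d)⁻¹ : ℝ) : EReal) * ENNReal.log (P {ω | rEst K h X Y x n ω ∈ A})

end NadarayaWatson

end

/-! The estimator is the quotient of the two components of `Z_n = (m_n, g_n)`, and `Z_n` obeys a
Gärtner–Ellis principle at speed `a_n = n h_n^d`. Indeed `a_n ⟨l, Z_n⟩` is a sum of `n` i.i.d.
terms, each with exponential moment `1 + h_n^d ψ_n(l)`, where the substitution `t = x - h_n z`
produces the factor `h_n^d` and (A2) with dominated convergence gives `ψ_n(l) → Ψ_x(l)`. Hence `(1 +
h_n^d ψ_n)^n` behaves like `exp (a_n Ψ_x)` (`IsSample.hasScaledMgfLimit`). As `Ψ_x` is finite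
everywhere, continuous (by convexity) and differentiable along lines, both Gärtner–Ellis bounds hold
with rate `I_x`.

The upper Gärtner–Ellis bound is Chernoff's inequality on finitely many half-spaces. The lower bound
uses no change of measure: at a gradient `w` of `Λ` at `l`, the part of the moment generating
function at `l` coming from outside a small ball around `w` is exponentially negligible, and a
quadratic penalty finds gradients near any point of finite rate (`exists_gradient_near`).

Division is continuous only off the hyperplane `g = 0`. The preimage of an open `U` off it is open,
whence the restriction `t ≠ 0` in `J^*`. For a closed `V` the whole hyperplane has to be added to
obtain a closed set; by (C) its infimal rate is the rate at the origin, which is the point `t = 0`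
on every line `(t s, t)` and so is already counted in `J`. -/

/-! ### Gärtner–Ellis bounds for a limit `Λ` that is finite everywhere -/

section GartnerEllis

variable {Ω : Type*} [MeasurableSpace Ω]
  {F : Type*} [NormedAddCommGroup F] [InnerProductSpace ℝ F]

/-- The scaled cumulant generating functions `(a n)⁻¹ log E[exp (a n ⟪l, Z n⟫)]` are finite for
large `n` and converge pointwise to `Λ`, at speed `a n → ∞`. -/
structure HasScaledMgfLimit (P : Measure Ω) (a : ℕ → ℝ) (Z : ℕ → Ω → F) (Λ : F → ℝ) : Prop where
  speed : Tendsto a atTop atTop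
  integrable : ∀ l, ∀ᶠ n in atTop, Integrable (fun ω => Real.exp (a n * inner ℝ l (Z n ω))) P
  upper : ∀ l, ∀ ε > 0, ∀ᶠ n in atTop,
    mgf (fun ω => inner ℝ l (Z n ω)) P (a n) ≤ Real.exp (a n * (Λ l + ε))
  lower : ∀ l, ∀ ε > 0, ∀ᶠ n in atTop,
    Real.exp (a n * (Λ l - ε)) ≤ mgf (fun ω => inner ℝ l (Z n ω)) P (a n)

/-- A closed set on which the Legendre transform of `Λ` exceeds `c` is covered by finitely many
half-spaces `{w | c < ⟪l, w⟫ - Λ l}`. -/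
lemma exists_finset_halfspace_cover [FiniteDimensional ℝ F] (Λ : F → ℝ) {C : Set F}
    (hC : IsClosed C) {c : ℝ} (hc : ∀ w ∈ C, ∃ l, c < inner ℝ l w - Λ l) :
    ∃ S : Finset F, ∀ w ∈ C, ∃ l ∈ S, c < inner ℝ l w - Λ l := by
  classical
  set b := stdOrthonormalBasis ℝ F
  -- Outside the box of size `R`, some half-space with normal `±b i` already exceeds `c`, because
  -- `Λ` is finite there. Only the compact part inside the box needs a subcover, which is why closed
  -- sets suffice.
  set R : ℝ := |c| + ∑ i, (|Λ (b i)| + |Λ (-b i)|)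
  have hR : ∀ i, |c| + |Λ (b i)| + |Λ (-b i)| ≤ R := fun i => by
    have := Finset.single_le_sum (f := fun i => |Λ (b i)| + |Λ (-b i)|)
      (fun j _ => by positivity) (Finset.mem_univ i)
    simp only [R]; linarith
  set B : Set F := {w | ∀ i, |inner ℝ (b i) w| ≤ R}
  have hB : IsCompact (C ∩ B) := by
    refine Metric.isCompact_of_isClosed_isBounded (hC.inter ?_) ?_
    · simp only [B, Set.ofPred_forall]
      exact isClosed_iInter fun i => isClosed_le (by fun_prop) continuous_const
    · refine (Metric.isBounded_closedBall (x := (0 : F))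
        (r := ∑ _i : Fin (Module.finrank ℝ F), R)).subset ?_
      rintro w ⟨-, hw⟩
      rw [mem_closedBall_zero_iff, ← b.sum_repr' w]
      refine (norm_sum_le _ _).trans (Finset.sum_le_sum fun i _ => ?_)
      rw [norm_smul, b.norm_eq_one, mul_one]
      exact hw i
  obtain ⟨T, hT⟩ := hB.elim_finite_subcover (fun l : F => {w | c < inner ℝ l w - Λ l})
    (fun l => isOpen_lt continuous_const (by fun_prop))
    (fun w hw => Set.mem_iUnion.2 (hc w hw.1))
  refine ⟨T ∪ (Finset.univ.image b ∪ Finset.univ.image fun i => -b i), fun w hw => ?_⟩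
  by_cases hwB : w ∈ B
  · obtain ⟨l, hl, hlw⟩ := Set.mem_iUnion₂.1 (hT ⟨hw, hwB⟩)
    exact ⟨l, by simp [hl], hlw⟩
  · simp only [B, Set.mem_ofPred_eq, not_forall, not_le, lt_abs] at hwB
    obtain ⟨i, hi | hi⟩ := hwB
    · refine ⟨b i, by simp, ?_⟩
      linarith [hR i, le_abs_self c, le_abs_self (Λ (b i)), abs_nonneg (Λ (-b i))]
    · refine ⟨-b i, by simp, ?_⟩
      rw [inner_neg_left]
      linarith [hR i, le_abs_self c, le_abs_self (Λ (-b i)), abs_nonneg (Λ (b i))]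

lemma eventually_mul_exp_le {a : ℕ → ℝ} (ha : Tendsto a atTop atTop) (M : ℝ) {s t : ℝ}
    (hst : s < t) : ∀ᶠ n in atTop, M * Real.exp (a n * s) ≤ Real.exp (a n * t) := by
  have := Real.tendsto_exp_atTop.comp (ha.atTop_mul_const (sub_pos.2 hst))
  filter_upwards [this.eventually_ge_atTop M] with n hn
  calc M * Real.exp (a n * s) ≤ Real.exp (a n * (t - s)) * Real.exp (a n * s) := by
        gcongr; exact hn
    _ = Real.exp (a n * t) := by rw [← Real.exp_add]; ring_nf

/-- Upper bound of the Gärtner–Ellis theorem. -/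
theorem HasScaledMgfLimit.upper_bound [FiniteDimensional ℝ F] {P : Measure Ω}
    [IsProbabilityMeasure P] {a : ℕ → ℝ} {Z : ℕ → Ω → F} {Λ : F → ℝ}
    (H : HasScaledMgfLimit P a Z Λ) {C : Set F}
    (hC : IsClosed C) {c c' : ℝ} (hc : ∀ w ∈ C, ∃ l, c < inner ℝ l w - Λ l) (hc' : c' < c) :
    ∀ᶠ n in atTop, P.real {ω | Z n ω ∈ C} ≤ Real.exp (a n * -c') := by
  obtain ⟨S, hS⟩ := exists_finset_halfspace_cover Λ hC hc
  have hε : 0 < (c - c') / 2 := by linarith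
  -- Half of the slack `c - c'` pays for the error in the limit of the generating function, the
  -- other half for the number of half-spaces.
  filter_upwards [(Finset.eventually_all S).2 fun l _ => H.integrable l,
    (Finset.eventually_all S).2 fun l _ => H.upper l _ hε, H.speed.eventually_ge_atTop 0,
    eventually_mul_exp_le H.speed S.card (show -(c + c') / 2 < -c' by linarith)]
    with n hint hup ha hcard
  calc P.real {ω | Z n ω ∈ C}
      ≤ P.real (⋃ l ∈ S, {ω | c + Λ l ≤ inner ℝ l (Z n ω)}) := by
        refine measureReal_mono (fun ω hω => ?_) (measure_ne_top _ _)
        obtain ⟨l, hl, hlw⟩ := hS _ hω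
        exact Set.mem_iUnion₂.2 ⟨l, hl, by simp only [Set.mem_ofPred_eq]; linarith⟩
    _ ≤ ∑ l ∈ S, P.real {ω | c + Λ l ≤ inner ℝ l (Z n ω)} := measureReal_biUnion_finset_le _ _
    _ ≤ ∑ l ∈ S, Real.exp (a n * (-(c + c') / 2)) := by
        refine Finset.sum_le_sum fun l hl => ?_
        refine (measure_ge_le_exp_mul_mgf _ ha (hint l hl)).trans ?_
        refine (mul_le_mul_of_nonneg_left (hup l hl) (Real.exp_nonneg _)).trans_eq ?_
        rw [← Real.exp_add]; ring_nf
    _ = S.card * Real.exp (a n * (-(c + c') / 2)) := by simp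
    _ ≤ _ := hcard

/-- Lower bound of the Gärtner–Ellis theorem around an exposed point `w`, the gradient of `Λ`
at `l`. -/
lemma HasScaledMgfLimit.lower_bound_of_hasDerivAt [FiniteDimensional ℝ F] {P : Measure Ω}
    [IsProbabilityMeasure P] {a : ℕ → ℝ} {Z : ℕ → Ω → F} {Λ : F → ℝ}
    (H : HasScaledMgfLimit P a Z Λ) {l w : F}
    (hderiv : ∀ e, HasDerivAt (fun η : ℝ => Λ (l + η • e)) (inner ℝ e w) 0)
    {G : Set F} (hG : IsOpen G) (hw : w ∈ G) {c : ℝ} (hc : inner ℝ l w - Λ l < c) :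
    ∀ᶠ n in atTop, Real.exp (a n * -c) ≤ P.real {ω | Z n ω ∈ G} := by
  classical
  set γ : ℝ := c - (inner ℝ l w - Λ l) with hγ_def
  have hγ : 0 < γ := sub_pos.2 hc
  obtain ⟨ρ, hρ, hρG, hlρ⟩ : ∃ ρ > 0, Metric.ball w ρ ⊆ G ∧ ‖l‖ * ρ ≤ γ / 4 := by
    obtain ⟨ρ₀, hρ₀, hsub⟩ := Metric.isOpen_iff.1 hG w hw
    refine ⟨min ρ₀ (γ / (4 * (‖l‖ + 1))), by positivity,
      (Metric.ball_subset_ball (min_le_left _ _)).trans hsub, ?_⟩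
    calc ‖l‖ * min ρ₀ (γ / (4 * (‖l‖ + 1))) ≤ (‖l‖ + 1) * (γ / (4 * (‖l‖ + 1))) := by
          gcongr
          · linarith
          · exact min_le_right _ _
      _ = γ / 4 := by field_simp
  set b := stdOrthonormalBasis ℝ F
  set D : Finset F := Finset.univ.image b ∪ Finset.univ.image fun i => -b i
  obtain ⟨δ, hδ, hδD⟩ : ∃ δ > 0, ∀ z, (∀ e ∈ D, inner ℝ e (z - w) < δ) → ‖z - w‖ < ρ := by
    refine ⟨ρ / (Module.finrank ℝ F + 1), by positivity, fun z hz => ?_⟩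
    rw [← b.sum_repr' (z - w)]
    calc ‖∑ i, inner ℝ (b i) (z - w) • b i‖
        ≤ ∑ i : Fin (Module.finrank ℝ F), ρ / (Module.finrank ℝ F + 1) := by
          refine (norm_sum_le _ _).trans (Finset.sum_le_sum fun i _ => ?_)
          rw [norm_smul, b.norm_eq_one, mul_one, Real.norm_eq_abs, abs_le]
          have h1 := hz (b i) (by simp [D])
          have h2 := hz (-b i) (by simp [D])
          rw [inner_neg_left] at h2
          constructor <;> linarith
      _ = ρ * (Module.finrank ℝ F / (Module.finrank ℝ F + 1)) := by
          simp; ring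
      _ < ρ * 1 := by
          gcongr
          rw [div_lt_one (by positivity)]
          linarith
      _ = ρ := mul_one ρ
  -- First-order expansion at `l`, where the gradient is `w`: tilting further by `η • e` costs only
  -- `η δ / 2` beyond the linear term, while leaving the ball in direction `e` gains `η δ`.
  obtain ⟨η, hη, hηD⟩ : ∃ η > 0, ∀ e ∈ D, Λ (l + η • e) ≤ Λ l + η * inner ℝ e w + η * (δ / 2) := by
    have key : ∀ e ∈ D, ∀ᶠ η : ℝ in 𝓝[>] 0,
        Λ (l + η • e) ≤ Λ l + η * inner ℝ e w + η * (δ / 2) := by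
      intro e _
      have h1 := (hderiv e).isLittleO.def (half_pos hδ)
      filter_upwards [nhdsWithin_le_nhds h1, self_mem_nhdsWithin] with η h2 h3
      have h3 : 0 < η := h3
      simp only [zero_smul, add_zero, sub_zero, smul_eq_mul, Real.norm_eq_abs,
        abs_of_pos h3] at h2
      have := (abs_le.1 h2).2
      linarith
    obtain ⟨η, h1, h2⟩ := (((Finset.eventually_all D).2 key).and self_mem_nhdsWithin).exists
    exact ⟨η, h2, h1⟩
  -- The bound `η δ / 8` makes the exterior terms at most `exp (a n * (Λ l - 3 * κ))`, well below
  -- the lower bound `exp (a n * (Λ l - κ))`; the bound `γ / 8` leaves at least `γ / 2` of the slack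
  -- `γ` after the loss `γ / 4` in the ball.
  set κ : ℝ := min (γ / 8) (η * δ / 8)
  have hκ : 0 < κ := by positivity
  have hκ1 : κ ≤ γ / 8 := min_le_left _ _
  have hκ2 : κ ≤ η * δ / 8 := min_le_right _ _
  filter_upwards [H.integrable l, H.lower l κ hκ,
    (Finset.eventually_all D).2 fun e _ => H.integrable (l + η • e),
    (Finset.eventually_all D).2 fun e _ => H.upper (l + η • e) _ hκ,
    H.speed.eventually_ge_atTop 0,
    eventually_mul_exp_le H.speed (2 * D.card) (show Λ l - 3 * κ < Λ l - κ by linarith),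
    eventually_mul_exp_le H.speed 2 (show -c < -c + γ / 2 by linarith)]
    with n hint hlow hintD hupD ha hcard hfin
  -- `Z n` need not be measurable, so the event is replaced by a measurable hull of the same measure
  -- before integrating its indicator.
  set T : Set Ω := toMeasurable P {ω | Z n ω ∈ G}
  have hT : MeasurableSet T := measurableSet_toMeasurable _ _
  have hPT : P.real T = P.real {ω | Z n ω ∈ G} := by
    simp only [T, measureReal_def, measure_toMeasurable]
  have hpt : ∀ ω, Real.exp (a n * inner ℝ l (Z n ω)) ≤
      T.indicator (fun _ => Real.exp (a n * (inner ℝ l w + γ / 4))) ω +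
      ∑ e ∈ D, Real.exp (a n * inner ℝ (l + η • e) (Z n ω)) *
        Real.exp (-(a n * (η * (inner ℝ e w + δ)))) := by
    intro ω
    by_cases hω : ∀ e ∈ D, inner ℝ e (Z n ω - w) < δ
    · have h1 := hδD _ hω
      have hωT : ω ∈ T := subset_toMeasurable _ _
        (hρG (by rwa [Metric.mem_ball, dist_eq_norm]) : ω ∈ {ω | Z n ω ∈ G})
      rw [Set.indicator_of_mem hωT]
      have h2 : inner ℝ l (Z n ω) ≤ inner ℝ l w + γ / 4 := by
        have h3 : inner ℝ l (Z n ω - w) ≤ ‖l‖ * ‖Z n ω - w‖ := real_inner_le_norm _ _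
        have h4 : ‖l‖ * ‖Z n ω - w‖ ≤ ‖l‖ * ρ := by gcongr
        rw [inner_sub_right] at h3
        linarith
      have h5 : Real.exp (a n * inner ℝ l (Z n ω)) ≤
        Real.exp (a n * (inner ℝ l w + γ / 4)) := by gcongr
      have h6 : 0 ≤ ∑ e ∈ D, Real.exp (a n * inner ℝ (l + η • e) (Z n ω)) *
        Real.exp (-(a n * (η * (inner ℝ e w + δ)))) := by positivity
      linarith
    · push Not at hω
      obtain ⟨e, heD, he⟩ := hω
      have h1 : Real.exp (a n * inner ℝ l (Z n ω)) ≤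
          Real.exp (a n * inner ℝ (l + η • e) (Z n ω)) *
            Real.exp (-(a n * (η * (inner ℝ e w + δ)))) := by
        rw [← Real.exp_add, Real.exp_le_exp, inner_add_left, real_inner_smul_left]
        rw [inner_sub_right] at he
        have : 0 ≤ a n * (η * (inner ℝ e (Z n ω) - inner ℝ e w - δ)) :=
          mul_nonneg ha (mul_nonneg hη.le (by linarith))
        linarith
      have h2 := Finset.single_le_sum (f := fun e =>
        Real.exp (a n * inner ℝ (l + η • e) (Z n ω)) *
        Real.exp (-(a n * (η * (inner ℝ e w + δ))))) (fun _ _ => by positivity) heD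
      have h3 : 0 ≤ T.indicator (fun _ => Real.exp (a n * (inner ℝ l w + γ / 4))) ω :=
        Set.indicator_nonneg (fun _ _ => Real.exp_nonneg _) ω
      linarith
  have hsum : ∑ e ∈ D, mgf (fun ω => inner ℝ (l + η • e) (Z n ω)) P (a n) *
      Real.exp (-(a n * (η * (inner ℝ e w + δ)))) ≤ D.card * Real.exp (a n * (Λ l - 3 * κ)) := by
    rw [← nsmul_eq_mul]
    refine Finset.sum_le_card_nsmul _ _ _ fun e he => ?_
    refine (mul_le_mul_of_nonneg_right (hupD e he) (Real.exp_nonneg _)).trans ?_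
    rw [← Real.exp_add, Real.exp_le_exp]
    have h1 := hηD e he
    have : a n * (Λ (l + η • e) + κ - η * (inner ℝ e w + δ)) ≤ a n * (Λ l - 3 * κ) :=
      mul_le_mul_of_nonneg_left (by linarith) ha
    linarith
  have hmain : mgf (fun ω => inner ℝ l (Z n ω)) P (a n) ≤
      P.real T * Real.exp (a n * (inner ℝ l w + γ / 4)) +
      ∑ e ∈ D, mgf (fun ω => inner ℝ (l + η • e) (Z n ω)) P (a n) *
        Real.exp (-(a n * (η * (inner ℝ e w + δ)))) := by
    have hi1 : Integrable (T.indicator fun _ => Real.exp (a n * (inner ℝ l w + γ / 4))) P :=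
      (integrable_const _).indicator hT
    have hi2 : ∀ e ∈ D, Integrable (fun ω => Real.exp (a n * inner ℝ (l + η • e) (Z n ω)) *
        Real.exp (-(a n * (η * (inner ℝ e w + δ))))) P := fun e he => (hintD e he).mul_const _
    have h := integral_mono hint (hi1.add (integrable_finsetSum _ hi2)) hpt
    simp only [Pi.add_apply] at h
    rw [integral_add hi1 (integrable_finsetSum _ hi2), integral_indicator_const _ hT,
      integral_finsetSum _ hi2] at h
    simp only [integral_mul_const, smul_eq_mul] at h
    exact h
  have h1 : Real.exp (a n * (Λ l - κ)) ≤
      2 * (P.real T * Real.exp (a n * (inner ℝ l w + γ / 4))) := by linarith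
  have h2 : Real.exp (a n * (-c + γ / 2)) * Real.exp (a n * (inner ℝ l w + γ / 4)) ≤
      Real.exp (a n * (Λ l - κ)) := by
    rw [← Real.exp_add, Real.exp_le_exp, ← mul_add]
    gcongr
    linarith
  have h3 : Real.exp (a n * -c) * Real.exp (a n * (inner ℝ l w + γ / 4)) ≤
      P.real T * Real.exp (a n * (inner ℝ l w + γ / 4)) := by
    have := mul_le_mul_of_nonneg_right hfin (Real.exp_nonneg (a n * (inner ℝ l w + γ / 4)))
    linarith
  rw [← hPT]
  exact le_of_mul_le_mul_right h3 (Real.exp_pos _)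

/-- If the Legendre transform of `Λ` is at most `c` at `w`, then there are points `w'` arbitrarily
close to `w` which are gradients of `Λ`, and at which it is at most `c` too. -/
lemma exists_gradient_near [FiniteDimensional ℝ F] {Λ : F → ℝ} (hcont : Continuous Λ)
    (hdiff : ∀ l e, DifferentiableAt ℝ (fun η : ℝ => Λ (l + η • e)) 0) {w : F} {c : ℝ}
    (hc : ∀ l, inner ℝ l w - Λ l ≤ c) {G : Set F} (hG : IsOpen G) (hw : w ∈ G) :
    ∃ l, ∃ w' ∈ G, (∀ e, HasDerivAt (fun η : ℝ => Λ (l + η • e)) (inner ℝ e w') 0) ∧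
      inner ℝ l w' - Λ l ≤ c := by
  obtain ⟨ρ, hρ, hρG⟩ := Metric.isOpen_iff.1 hG w hw
  set M : ℝ := c + Λ 0
  have hM : 0 ≤ M := by have := hc 0; simp only [inner_zero_left] at this; simp only [M]; linarith
  -- Small enough that `ε * (2 * M) < ρ ^ 2`, which keeps `w - ε • l` in the ball; the `+ 1` covers
  -- `M = 0`.
  set ε : ℝ := ρ ^ 2 / (2 * M + 1) / 2
  have hε : 0 < ε := by positivity
  have hεM : ε * (2 * M) < ρ ^ 2 := by
    have h1 : ε * (2 * M + 1) = ρ ^ 2 / 2 := by simp only [ε]; field_simp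
    nlinarith [sq_nonneg ρ, pow_pos hρ 2]
  -- The bound on the Legendre transform at `w` bounds `Λ - ⟨·, w⟩` from below, so the penalty makes
  -- `φ` coercive. At a minimizer `l` the first-order condition says that `Λ` has gradient `w - ε •
  -- l`.
  set φ : F → ℝ := fun l => Λ l - inner ℝ l w + ε / 2 * ‖l‖ ^ 2
  have hsub : ∀ l, φ l ≤ φ 0 → ε * ‖l‖ ^ 2 ≤ 2 * M := by
    intro l hl
    simp only [φ, inner_zero_left, norm_zero] at hl
    have := hc l
    simp only [M]
    linarith
  obtain ⟨l, hl⟩ : ∃ l, ∀ l', φ l ≤ φ l' := by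
    refine Continuous.exists_forall_le_of_isBounded (by fun_prop) 0 ?_
    refine (Metric.isBounded_closedBall (x := (0 : F)) (r := √(2 * M / ε))).subset fun l hl => ?_
    rw [mem_closedBall_zero_iff]
    refine Real.le_sqrt_of_sq_le ?_
    rw [le_div_iff₀ hε]
    linarith [hsub l hl]
  refine ⟨l, w - ε • l, hρG ?_, fun e => ?_, ?_⟩
  · rw [Metric.mem_ball, dist_eq_norm, sub_sub_cancel_left, norm_neg, norm_smul,
      Real.norm_of_nonneg hε.le]
    refine lt_of_pow_lt_pow_left₀ 2 hρ.le ?_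
    have := hsub l (hl 0)
    calc (ε * ‖l‖) ^ 2 = ε * (ε * ‖l‖ ^ 2) := by ring
      _ ≤ ε * (2 * M) := by gcongr
      _ < ρ ^ 2 := hεM
  · have h1 := (hdiff l e).hasDerivAt
    have h2 : HasDerivAt (fun η : ℝ => l + η • e) e 0 := by
      simpa using ((hasDerivAt_id (0 : ℝ)).smul_const e).const_add l
    have h3 : HasDerivAt (fun η : ℝ => inner ℝ (l + η • e) w) (inner ℝ e w) 0 := by
      simpa using h2.inner ℝ (hasDerivAt_const (0 : ℝ) w)
    have h4 : HasDerivAt (fun η : ℝ => ‖l + η • e‖ ^ 2) (2 * inner ℝ l e) 0 := by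
      simpa using h2.norm_sq
    have h5 := (h1.sub h3).add (h4.const_mul (ε / 2))
    have h6 : IsLocalMin (fun η : ℝ => φ (l + η • e)) 0 :=
      Eventually.of_forall fun η => by simpa using hl (l + η • e)
    have h7 := h6.hasDerivAt_eq_zero h5
    have h8 : inner ℝ e (w - ε • l) = deriv (fun η : ℝ => Λ (l + η • e)) 0 := by
      rw [inner_sub_right, real_inner_smul_right, real_inner_comm l e]
      linarith
    rwa [h8]
  · have h1 := hc l
    rw [inner_sub_right, real_inner_smul_right, real_inner_self_eq_norm_sq]
    have : 0 ≤ ε * ‖l‖ ^ 2 := by positivity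
    linarith

/-- Lower bound of the Gärtner–Ellis theorem, for a continuous `Λ` with directional derivatives. -/
theorem HasScaledMgfLimit.lower_bound [FiniteDimensional ℝ F] {P : Measure Ω}
    [IsProbabilityMeasure P] {a : ℕ → ℝ} {Z : ℕ → Ω → F} {Λ : F → ℝ}
    (H : HasScaledMgfLimit P a Z Λ) (hcont : Continuous Λ)
    (hdiff : ∀ l e, DifferentiableAt ℝ (fun η : ℝ => Λ (l + η • e)) 0) {w : F} {c c' : ℝ}
    (hc : ∀ l, inner ℝ l w - Λ l ≤ c) (hc' : c < c') {G : Set F} (hG : IsOpen G) (hw : w ∈ G) :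
    ∀ᶠ n in atTop, Real.exp (a n * -c') ≤ P.real {ω | Z n ω ∈ G} := by
  obtain ⟨l, w', hw', hd, hle⟩ := exists_gradient_near hcont hdiff hc hG hw
  exact H.lower_bound_of_hasDerivAt hd hG hw' (hle.trans_lt hc')

end GartnerEllis

/-! ### Integral bounds drawn from (A1) and (A2) -/

namespace NadarayaWatson

variable {d q : ℕ}

lemma exp_mul_abs_le (c s : ℝ) : Real.exp (c * |s|) ≤ Real.exp (c * s) + Real.exp (-c * s) := by
  rcases abs_choice s with h | h <;> rw [h]
  · linarith [Real.exp_pos (-c * s)]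
  · rw [mul_neg, ← neg_mul]
    linarith [Real.exp_pos (c * s)]

/-- From `|e^s - 1| ≤ |s| e^|s|`, with `|a|` absorbed into one more exponential. The factor `|k|`
will give integrability in `z`, and exponentials without absolute values are what (A2) controls in
`y`. -/
lemma abs_exp_mul_sub_one_le {a k C : ℝ} (hk : |k| ≤ C) :
    |Real.exp (a * k) - 1| ≤ |k| * (Real.exp ((C + 1) * a) + Real.exp (-(C + 1) * a)) := by
  have h1 : ∀ s : ℝ, |Real.exp s - 1| ≤ |s| * Real.exp |s| := by
    intro s
    rcases le_total 0 s with hs | hs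
    · rw [abs_of_nonneg hs, abs_of_nonneg (by linarith [Real.one_le_exp hs])]
      have h2 := mul_le_mul_of_nonneg_right (Real.add_one_le_exp (-s)) (Real.exp_nonneg s)
      rw [← Real.exp_add] at h2
      simp only [neg_add_cancel, Real.exp_zero] at h2
      linarith
    · rw [abs_of_nonpos hs, abs_of_nonpos (by linarith [Real.exp_le_one_iff.2 hs])]
      nlinarith [Real.add_one_le_exp s, Real.one_le_exp (neg_nonneg.2 hs)]
  have hC : 0 ≤ C := (abs_nonneg k).trans hk
  have h3 : |a| ≤ Real.exp |a| := by linarith [Real.add_one_le_exp |a|]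
  calc |Real.exp (a * k) - 1| ≤ |a * k| * Real.exp |a * k| := h1 _
    _ = |k| * (|a| * Real.exp (|k| * |a|)) := by rw [abs_mul, mul_comm |a|]; ring
    _ ≤ |k| * (Real.exp |a| * Real.exp (C * |a|)) := by gcongr
    _ = |k| * Real.exp ((C + 1) * |a|) := by rw [← Real.exp_add]; ring_nf
    _ ≤ _ := by gcongr; exact exp_mul_abs_le _ _

variable {f : E d → E q → ℝ} {x : E d}

lemma exp_mul_affine_eq (u y : E q) (v s : ℝ) :
    Real.exp (s * (inner ℝ u y + v)) = Real.exp (s * v) * Real.exp (inner ℝ (s • u) y) := by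
  rw [← Real.exp_add, real_inner_smul_left]; ring_nf

lemma CondA2.integrable_exp_mul (hA2 : CondA2 f x) (u : E q) (v s : ℝ) (t : E d) :
    Integrable fun y => Real.exp (s * (inner ℝ u y + v)) * f t y := by
  simp only [exp_mul_affine_eq, mul_assoc]
  exact (hA2.integrable (s • u) t).const_mul _

/-- Reduces a slice to the transforms of (A2) at `k • u` and at `0`, so that continuity at `x` can
be applied for each fixed `z`. -/
lemma CondA2.integral_slice (hA2 : CondA2 f x) (u : E q) (v k : ℝ) (t : E d) :
    ∫ y, (Real.exp ((inner ℝ u y + v) * k) - 1) * f t y =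
      Real.exp (k * v) * (∫ y, Real.exp (inner ℝ (k • u) y) * f t y) -
        ∫ y, Real.exp (inner ℝ (0 : E q) y) * f t y := by
  rw [← integral_const_mul, ← integral_sub ((hA2.integrable _ t).const_mul _) (hA2.integrable 0 t)]
  congr 1 with y
  rw [mul_comm _ k, exp_mul_affine_eq, inner_zero_left, Real.exp_zero]
  ring

lemma CondA2.exists_abs_integral_slice_le (hA2 : CondA2 f x) (hf0 : ∀ t y, 0 ≤ f t y)
    (u : E q) (v C : ℝ) : ∃ B, ∀ k t, |k| ≤ C →
      |∫ y, (Real.exp ((inner ℝ u y + v) * k) - 1) * f t y| ≤ |k| * B := by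
  obtain ⟨B₁, hB₁⟩ := hA2.bounded ((C + 1) • u)
  obtain ⟨B₂, hB₂⟩ := hA2.bounded ((-(C + 1)) • u)
  refine ⟨Real.exp ((C + 1) * v) * B₁ + Real.exp (-(C + 1) * v) * B₂, fun k t hk => ?_⟩
  have h1 := hA2.integrable_exp_mul u v (C + 1) t
  have h2 := hA2.integrable_exp_mul u v (-(C + 1)) t
  calc |∫ y, (Real.exp ((inner ℝ u y + v) * k) - 1) * f t y|
      ≤ ∫ y, |k| * (Real.exp ((C + 1) * (inner ℝ u y + v)) * f t y +
          Real.exp (-(C + 1) * (inner ℝ u y + v)) * f t y) := by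
        rw [← Real.norm_eq_abs (∫ _, _)]
        refine norm_integral_le_of_norm_le ((h1.add h2).const_mul _)
          (Eventually.of_forall fun y => ?_)
        rw [Real.norm_eq_abs, abs_mul, abs_of_nonneg (hf0 t y)]
        refine (mul_le_mul_of_nonneg_right (abs_exp_mul_sub_one_le hk) (hf0 t y)).trans_eq ?_
        ring
    _ = |k| * (Real.exp ((C + 1) * v) * (∫ y, Real.exp (inner ℝ ((C + 1) • u) y) * f t y) +
          Real.exp (-(C + 1) * v) * ∫ y, Real.exp (inner ℝ ((-(C + 1)) • u) y) * f t y) := by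
        rw [integral_const_mul, integral_add h1 h2]
        simp only [exp_mul_affine_eq, mul_assoc, integral_const_mul]
    _ ≤ _ := by
        gcongr
        · exact (le_abs_self _).trans (hB₁ t)
        · exact (le_abs_self _).trans (hB₂ t)

lemma measurable_density_comp (hf : Measurable fun p : E d × E q => f p.1 p.2) {τ : E d → E d}
    (hτ : Measurable τ) : Measurable fun p : E d × E q => f (τ p.1) p.2 :=
  hf.comp ((hτ.comp measurable_fst).prodMk measurable_snd)

/-- Tonelli: the `y`-integral is bounded uniformly in its base point, leaving a multiple of `|k|`.
The map `τ` covers the density frozen at `x`, taken at `x - r z`, and taken at the variable itself.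
-/
lemma CondA2.integrable_abs_mul_exp (hA2 : CondA2 f x) (hf0 : ∀ t y, 0 ≤ f t y)
    (hf : Measurable fun p : E d × E q => f p.1 p.2) {k : E d → ℝ} (hk : Integrable k)
    {τ : E d → E d} (hτ : Measurable τ) (u : E q) :
    Integrable fun p : E d × E q => |k p.1| * (Real.exp (inner ℝ u p.2) * f (τ p.1) p.2) := by
  have hm : AEStronglyMeasurable
      (fun p : E d × E q => |k p.1| * (Real.exp (inner ℝ u p.2) * f (τ p.1) p.2))
      ((volume : Measure (E d)).prod (volume : Measure (E q))) := by
    refine AEStronglyMeasurable.mul (hk.abs.aestronglyMeasurable.comp_fst) ?_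
    refine AEStronglyMeasurable.mul (by fun_prop) ?_
    exact (measurable_density_comp hf hτ).aestronglyMeasurable
  obtain ⟨B, hB⟩ := hA2.bounded u
  rw [Measure.volume_eq_prod, integrable_prod_iff hm]
  refine ⟨Eventually.of_forall fun z => (hA2.integrable u (τ z)).const_mul |k z|, ?_⟩
  refine (hk.abs.mul_const B).mono' hm.norm.integral_prod_right' (Eventually.of_forall fun z => ?_)
  rw [Real.norm_of_nonneg (integral_nonneg fun y => norm_nonneg _)]
  calc ∫ y, ‖|k z| * (Real.exp (inner ℝ u y) * f (τ z) y)‖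
      = |k z| * ∫ y, Real.exp (inner ℝ u y) * f (τ z) y := by
        rw [← integral_const_mul]
        congr 1 with y
        rw [Real.norm_of_nonneg]
        have := hf0 (τ z) y
        positivity
    _ ≤ _ := by
        gcongr
        exact (le_abs_self _).trans (hB _)

lemma aestronglyMeasurable_affine_mul {k : E d → ℝ} (hk : Integrable k) (u : E q) (v : ℝ) :
    AEStronglyMeasurable (fun p : E d × E q => (inner ℝ u p.2 + v) * k p.1)
      (volume : Measure (E d × E q)) := by
  rw [Measure.volume_eq_prod]
  exact AEStronglyMeasurable.mul (by fun_prop) hk.aestronglyMeasurable.comp_fst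

lemma CondA2.integrable_kernel (hA2 : CondA2 f x) (hf0 : ∀ t y, 0 ≤ f t y)
    (hf : Measurable fun p : E d × E q => f p.1 p.2) {k : E d → ℝ} (hk : Integrable k)
    {C : ℝ} (hC : ∀ z, |k z| ≤ C) {τ : E d → E d} (hτ : Measurable τ) (u : E q) (v : ℝ) :
    Integrable fun p : E d × E q =>
      (Real.exp ((inner ℝ u p.2 + v) * k p.1) - 1) * f (τ p.1) p.2 := by
  have h1 := (hA2.integrable_abs_mul_exp hf0 hf hk hτ ((C + 1) • u)).const_mul
    (Real.exp ((C + 1) * v))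
  have h2 := (hA2.integrable_abs_mul_exp hf0 hf hk hτ ((-(C + 1)) • u)).const_mul
    (Real.exp (-(C + 1) * v))
  refine (h1.add h2).mono' ?_ (Eventually.of_forall fun p => ?_)
  · exact ((Real.continuous_exp.comp_aestronglyMeasurable
      (aestronglyMeasurable_affine_mul hk u v)).sub aestronglyMeasurable_const).mul
      (measurable_density_comp hf hτ).aestronglyMeasurable
  · rw [Real.norm_eq_abs, abs_mul, abs_of_nonneg (hf0 _ _)]
    refine (mul_le_mul_of_nonneg_right (abs_exp_mul_sub_one_le (hC p.1)) (hf0 _ _)).trans_eq ?_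
    simp only [exp_mul_affine_eq, Pi.add_apply]
    ring

/-! ### Convergence to `Ψ_x`, and its regularity -/

variable {K : E d → ℝ}

/-- `∫ (e^{(⟨u,y⟩ + v) K(z)} - 1) f(x - r z, y) dz dy`. -/
noncomputable def smoothedPsi (K : E d → ℝ) (f : E d → E q → ℝ) (x : E d) (u : E q) (v r : ℝ) : ℝ :=
  ∫ p : E d × E q, (Real.exp ((inner ℝ u p.2 + v) * K p.1) - 1) * f (x - r • p.1) p.2

lemma tendsto_smoothedPsi (hA1 : CondA1 K) (hA2 : CondA2 f x) (hf0 : ∀ t y, 0 ≤ f t y)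
    (hf : Measurable fun p : E d × E q => f p.1 p.2) (u : E q) (v : ℝ) {h : ℕ → ℝ}
    (hlim : Tendsto h atTop (𝓝 0)) :
    Tendsto (fun n => smoothedPsi K f x u v (h n)) atTop (𝓝 (Psi K f x u v)) := by
  obtain ⟨C, hC⟩ := hA1.bounded
  have hint : ∀ {τ : E d → E d}, Measurable τ → Integrable fun p : E d × E q =>
      (Real.exp ((inner ℝ u p.2 + v) * K p.1) - 1) * f (τ p.1) p.2 := fun hτ =>
    hA2.integrable_kernel hf0 hf hA1.integrable hC hτ u v
  have hτ : ∀ r : ℝ, Measurable fun z : E d => x - r • z := fun r => by fun_prop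
  have h1 : ∀ n, smoothedPsi K f x u v (h n) =
      ∫ z, ∫ y, (Real.exp ((inner ℝ u y + v) * K z) - 1) * f (x - h n • z) y := fun n =>
    integral_prod _ (hint (hτ (h n)))
  have h2 : Psi K f x u v = ∫ z, ∫ y, (Real.exp ((inner ℝ u y + v) * K z) - 1) * f x y :=
    integral_prod _ (hint measurable_const)
  simp only [h1, h2]
  obtain ⟨B, hB⟩ := hA2.exists_abs_integral_slice_le hf0 u v C
  refine tendsto_integral_of_dominated_convergence (fun z => |K z| * B)
    (fun n => (hint (hτ (h n))).integral_prod_left.aestronglyMeasurable)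
    (hA1.integrable.abs.mul_const B)
    (fun n => Eventually.of_forall fun z => hB _ _ (hC z)) (Eventually.of_forall fun z => ?_)
  simp only [hA2.integral_slice]
  have h3 : Tendsto (fun n => x - h n • z) atTop (𝓝 x) := by
    simpa using (hlim.smul_const z).const_sub x
  exact (((hA2.continuousAt _).tendsto.comp h3).const_mul _).sub
    ((hA2.continuousAt _).tendsto.comp h3)

/-- `Psi` as a function on the Euclidean space `ℝ^q × ℝ`. -/
noncomputable def psiFun (K : E d → ℝ) (f : E d → E q → ℝ) (x : E d) (l : WithLp 2 (E q × ℝ)) : ℝ :=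
  Psi K f x l.fst l.snd

lemma convexOn_psiFun (hA1 : CondA1 K) (hA2 : CondA2 f x) (hf0 : ∀ t y, 0 ≤ f t y)
    (hf : Measurable fun p : E d × E q => f p.1 p.2) :
    ConvexOn ℝ Set.univ (psiFun K f x) := by
  obtain ⟨C, hC⟩ := hA1.bounded
  refine ⟨convex_univ, fun l _ m _ a b ha hb hab => ?_⟩
  have hint : ∀ l : WithLp 2 (E q × ℝ), Integrable fun p : E d × E q =>
      (Real.exp ((inner ℝ l.fst p.2 + l.snd) * K p.1) - 1) * f x p.2 := fun l =>
    hA2.integrable_kernel hf0 hf hA1.integrable hC (τ := fun _ => x) measurable_const _ _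
  simp only [psiFun, Psi, smul_eq_mul]
  rw [← integral_const_mul, ← integral_const_mul,
    ← integral_add ((hint l).const_mul a) ((hint m).const_mul b)]
  refine integral_mono (hint _) (((hint l).const_mul a).add ((hint m).const_mul b)) fun p => ?_
  have h1 := convexOn_exp.2 (Set.mem_univ ((inner ℝ l.fst p.2 + l.snd) * K p.1))
    (Set.mem_univ ((inner ℝ m.fst p.2 + m.snd) * K p.1)) ha hb hab
  simp only [smul_eq_mul] at h1
  have h2 : (inner ℝ (a • l + b • m).fst p.2 + (a • l + b • m).snd) * K p.1 =
      a * ((inner ℝ l.fst p.2 + l.snd) * K p.1) + b * ((inner ℝ m.fst p.2 + m.snd) * K p.1) := by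
    simp only [WithLp.add_fst, WithLp.smul_fst, WithLp.add_snd, WithLp.smul_snd, inner_add_left,
      real_inner_smul_left, smul_eq_mul]
    ring
  have h3 := mul_le_mul_of_nonneg_right h1 (hf0 x p.2)
  simp only [h2]
  have h4 : (1 - a - b) * f x p.2 = 0 := by rw [show 1 - a - b = 0 by linarith, zero_mul]
  linarith

/-- A finite convex function on a finite-dimensional space is continuous. -/
lemma continuous_psiFun (hA1 : CondA1 K) (hA2 : CondA2 f x) (hf0 : ∀ t y, 0 ≤ f t y)
    (hf : Measurable fun p : E d × E q => f p.1 p.2) : Continuous (psiFun K f x) :=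
  continuousOn_univ.1 ((convexOn_psiFun hA1 hA2 hf0 hf).continuousOn isOpen_univ)

lemma differentiableAt_psiFun_line (hA1 : CondA1 K) (hA2 : CondA2 f x) (hf0 : ∀ t y, 0 ≤ f t y)
    (hf : Measurable fun p : E d × E q => f p.1 p.2) (l e : WithLp 2 (E q × ℝ)) :
    DifferentiableAt ℝ (fun η : ℝ => psiFun K f x (l + η • e)) 0 := by
  obtain ⟨C, hC⟩ := hA1.bounded
  have hC0 : 0 ≤ C := (abs_nonneg _).trans (hC 0)
  set A : E q → ℝ := fun y => inner ℝ l.fst y + l.snd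
  set B : E q → ℝ := fun y => inner ℝ e.fst y + e.snd
  have hpsi : ∀ η : ℝ, psiFun K f x (l + η • e) =
      ∫ p : E d × E q, (Real.exp ((A p.2 + η * B p.2) * K p.1) - 1) * f x p.2 := by
    intro η
    simp only [psiFun, Psi, A, B, WithLp.add_fst, WithLp.smul_fst, WithLp.add_snd,
      WithLp.smul_snd, inner_add_left, real_inner_smul_left, smul_eq_mul]
    congr 1 with p
    ring_nf
  have hint : ∀ η : ℝ, Integrable fun p : E d × E q =>
      (Real.exp ((A p.2 + η * B p.2) * K p.1) - 1) * f x p.2 := by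
    intro η
    have := hA2.integrable_kernel hf0 hf hA1.integrable hC (τ := fun _ => x) measurable_const
      (l.fst + η • e.fst) (l.snd + η * e.snd)
    refine this.congr (Eventually.of_forall fun p => ?_)
    simp only [A, B, inner_add_left, real_inner_smul_left]
    ring_nf
  have hbd : ∀ s t : ℝ, Integrable fun p : E d × E q =>
      |K p.1| * (Real.exp (s * A p.2 + t * B p.2) * f x p.2) := by
    intro s t
    have := (hA2.integrable_abs_mul_exp hf0 hf hA1.integrable (τ := fun _ => x) measurable_const
      (s • l.fst + t • e.fst)).const_mul (Real.exp (s * l.snd + t * e.snd))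
    refine this.congr (Eventually.of_forall fun p => ?_)
    simp only [A, B]
    rw [show s * (inner ℝ l.fst p.2 + l.snd) + t * (inner ℝ e.fst p.2 + e.snd) =
      (s * l.snd + t * e.snd) + inner ℝ (s • l.fst + t • e.fst) p.2 by
        rw [inner_add_left, real_inner_smul_left, real_inner_smul_left]; ring,
      Real.exp_add (s * l.snd + t * e.snd) (inner ℝ _ _)]
    ring
  -- The extra `1` absorbs the factor `|B|` created by differentiation. The four terms of `bound`
  -- come from expanding `(e^{cA} + e^{-cA}) (e^{cB} + e^{-cB})`, which dominates `e^{c|A| + c|B|}`.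
  set c : ℝ := C + 1
  set bound : E d × E q → ℝ := fun p =>
    (|K p.1| * (Real.exp (c * A p.2 + c * B p.2) * f x p.2) +
      |K p.1| * (Real.exp (c * A p.2 + -c * B p.2) * f x p.2)) +
    (|K p.1| * (Real.exp (-c * A p.2 + c * B p.2) * f x p.2) +
      |K p.1| * (Real.exp (-c * A p.2 + -c * B p.2) * f x p.2))
  have hbound : Integrable bound :=
    ((hbd _ _).add (hbd _ _)).add ((hbd _ _).add (hbd _ _))
  have hK : AEStronglyMeasurable (fun p : E d × E q => K p.1) volume := by
    rw [Measure.volume_eq_prod]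
    exact hA1.integrable.aestronglyMeasurable.comp_fst
  have hfx : AEStronglyMeasurable (fun p : E d × E q => f x p.2) volume :=
    (measurable_density_comp hf (τ := fun _ => x) measurable_const).aestronglyMeasurable
  have hAm : AEStronglyMeasurable (fun p : E d × E q => A p.2) volume := by
    simp only [A]; fun_prop
  have hBm : AEStronglyMeasurable (fun p : E d × E q => B p.2) volume := by
    simp only [B]; fun_prop
  have hkey := hasDerivAt_integral_of_dominated_loc_of_deriv_le (μ := (volume : Measure (E d × E q)))
    (F := fun η p => (Real.exp ((A p.2 + η * B p.2) * K p.1) - 1) * f x p.2)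
    (F' := fun η p => Real.exp ((A p.2 + η * B p.2) * K p.1) * (B p.2 * K p.1) * f x p.2)
    (x₀ := (0 : ℝ)) (s := Metric.ball 0 1) (bound := bound)
    (Metric.ball_mem_nhds _ one_pos)
    (Eventually.of_forall fun η => (hint η).aestronglyMeasurable) (hint 0)
    (((Real.continuous_exp.comp_aestronglyMeasurable
      ((hAm.add (hBm.const_mul 0)).mul hK)).mul (hBm.mul hK)).mul hfx)
    (Eventually.of_forall fun p η hη => ?_) hbound
    (Eventually.of_forall fun p η _ => ?_)
  · simp only [hpsi]
    exact hkey.2.differentiableAt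
  · rw [mem_ball_zero_iff, Real.norm_eq_abs] at hη
    have h1 : |B p.2| ≤ Real.exp |B p.2| := by linarith [Real.add_one_le_exp |B p.2|]
    have h2 : (A p.2 + η * B p.2) * K p.1 ≤ C * |A p.2| + C * |B p.2| := by
      calc (A p.2 + η * B p.2) * K p.1 ≤ |(A p.2 + η * B p.2) * K p.1| := le_abs_self _
        _ = |A p.2 + η * B p.2| * |K p.1| := abs_mul _ _
        _ ≤ (|A p.2| + |η| * |B p.2|) * C := by
            gcongr
            · exact (abs_add_le _ _).trans_eq (by rw [abs_mul])
            · exact hC _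
        _ ≤ (|A p.2| + 1 * |B p.2|) * C := by gcongr
        _ = _ := by ring
    have h3 : Real.exp (c * |A p.2|) * Real.exp (c * |B p.2|) ≤
        (Real.exp (c * A p.2) + Real.exp (-c * A p.2)) *
        (Real.exp (c * B p.2) + Real.exp (-c * B p.2)) := by
      gcongr
      · exact exp_mul_abs_le _ _
      · exact exp_mul_abs_le _ _
    have hf := hf0 x p.2
    rw [Real.norm_eq_abs, abs_mul, abs_mul, abs_mul, Real.abs_exp, abs_of_nonneg hf]
    calc Real.exp ((A p.2 + η * B p.2) * K p.1) * (|B p.2| * |K p.1|) * f x p.2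
        ≤ Real.exp (C * |A p.2| + C * |B p.2|) *
            (Real.exp (|A p.2| + |B p.2|) * |K p.1|) * f x p.2 := by
          gcongr
          exact h1.trans (Real.exp_le_exp.2 (by linarith [abs_nonneg (A p.2)]))
      _ = |K p.1| * (Real.exp (c * |A p.2|) * Real.exp (c * |B p.2|)) * f x p.2 := by
          rw [← mul_assoc (Real.exp _), ← Real.exp_add, ← Real.exp_add]
          simp only [c]
          ring_nf
      _ ≤ |K p.1| * ((Real.exp (c * A p.2) + Real.exp (-c * A p.2)) *
            (Real.exp (c * B p.2) + Real.exp (-c * B p.2))) * f x p.2 := by gcongr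
      _ = bound p := by
          simp only [bound, Real.exp_add]
          ring
  · have h1 : HasDerivAt (fun η : ℝ => (A p.2 + η * B p.2) * K p.1) (B p.2 * K p.1) η := by
      simpa using (((hasDerivAt_id η).mul_const (B p.2)).const_add (A p.2)).mul_const (K p.1)
    exact (h1.exp.sub_const 1).mul_const _

/-! ### Moment generating function of the pair `(m_n, g_n)` -/

variable {Ω : Type*} {X : ℕ → Ω → E d} {Y : ℕ → Ω → E q}

/-- The pair `(m_n, g_n)` of numerator and denominator of the estimator. -/
noncomputable def pairEst (K : E d → ℝ) (h : ℕ → ℝ) (X : ℕ → Ω → E d) (Y : ℕ → Ω → E q) (x : E d)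
    (n : ℕ) (ω : Ω) : WithLp 2 (E q × ℝ) :=
  WithLp.toLp 2 (mEst K h X Y x n ω, gEst K h X x n ω)

lemma speed_mul_inner_pairEst {h : ℕ → ℝ} {n : ℕ} (hn : (n : ℝ) * h n ^ d ≠ 0)
    (l : WithLp 2 (E q × ℝ)) (ω : Ω) :
    (n : ℝ) * h n ^ d * inner ℝ l (pairEst K h X Y x n ω) =
      ∑ i ∈ Finset.range n, (inner ℝ l.fst (Y i ω) + l.snd) * K ((h n)⁻¹ • (x - X i ω)) := by
  rw [WithLp.prod_inner_apply]
  simp only [pairEst, mEst, gEst, inner_smul_right, inner_sum, RCLike.inner_apply, conj_trivial]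
  rw [mul_assoc _ _ l.ofLp.2, ← mul_add, mul_inv_cancel_left₀ hn, Finset.sum_mul,
    ← Finset.sum_add_distrib]
  exact Finset.sum_congr rfl fun i _ => by rw [WithLp.fst, WithLp.snd]; ring

variable [MeasurableSpace Ω] {P : Measure Ω}

lemma CondA1.integrable_rescaled (hA1 : CondA1 K) (x : E d) {r : ℝ} (hr : 0 < r) :
    Integrable fun z => K (r⁻¹ • (x - z)) :=
  (hA1.integrable.comp_smul (inv_ne_zero hr.ne')).comp_sub_left x

/-- `K` is only almost everywhere measurable for Lebesgue measure; absolute continuity of the law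
carries this over. -/
lemma IsSample.aemeasurable_summand (hXY : IsSample P X Y f) (hA1 : CondA1 K) (u : E q) (v : ℝ)
    {r : ℝ} (hr : 0 < r) (i : ℕ) :
    AEMeasurable (fun p : E d × E q => (inner ℝ u p.2 + v) * K (r⁻¹ • (x - p.1)))
      (P.map fun ω => (X i ω, Y i ω)) := by
  rw [hXY.law i]
  exact (aestronglyMeasurable_affine_mul (hA1.integrable_rescaled x hr) u v).aemeasurable.mono_ac
    (withDensity_absolutelyContinuous _ _)

/-- The substitution `t = x - r z`, whose Jacobian is `r ^ d`. -/
lemma integral_rescaled_kernel (hA1 : CondA1 K) (hA2 : CondA2 f x) (hf0 : ∀ t y, 0 ≤ f t y)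
    (hf : Measurable fun p : E d × E q => f p.1 p.2) (u : E q) (v : ℝ) {r : ℝ} (hr : 0 < r) :
    ∫ p : E d × E q, (Real.exp ((inner ℝ u p.2 + v) * K (r⁻¹ • (x - p.1))) - 1) * f p.1 p.2 =
      r ^ d * smoothedPsi K f x u v r := by
  obtain ⟨C, hC⟩ := hA1.bounded
  have h1 := integral_prod _ (hA2.integrable_kernel hf0 hf (hA1.integrable_rescaled x hr)
    (fun z => hC _) measurable_id u v)
  have h2 : smoothedPsi K f x u v r =
      ∫ z, ∫ y, (Real.exp ((inner ℝ u y + v) * K z) - 1) * f (x - r • z) y :=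
    integral_prod _ (hA2.integrable_kernel hf0 hf hA1.integrable hC
      (τ := fun z => x - r • z) (by fun_prop) u v)
  set Φ : E d → ℝ := fun t =>
    ∫ y, (Real.exp ((inner ℝ u y + v) * K (r⁻¹ • (x - t))) - 1) * f t y
  have h3 : smoothedPsi K f x u v r = ∫ z, Φ (x - r • z) := by
    rw [h2]
    simp only [Φ, sub_sub_cancel, smul_smul, inv_mul_cancel₀ hr.ne', one_smul]
  have h4 := Measure.integral_comp_smul_of_nonneg (volume : Measure (E d)) (fun z => Φ (x - z)) r
    (hR := hr.le)
  rw [integral_sub_left_eq_self Φ, finrank_euclideanSpace_fin, smul_eq_mul] at h4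
  rw [h3, h4, mul_inv_cancel_left₀ (pow_pos hr d).ne']
  exact h1

lemma IsSample.integrable_and_mgf_summand [IsProbabilityMeasure P] (hXY : IsSample P X Y f)
    (hA1 : CondA1 K) (hA2 : CondA2 f x) (u : E q) (v : ℝ) {r : ℝ} (hr : 0 < r) (i : ℕ) :
    Integrable (fun ω => Real.exp ((inner ℝ u (Y i ω) + v) * K (r⁻¹ • (x - X i ω)))) P ∧
    mgf (fun ω => (inner ℝ u (Y i ω) + v) * K (r⁻¹ • (x - X i ω))) P 1 =
      1 + r ^ d * smoothedPsi K f x u v r := by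
  obtain ⟨C, hC⟩ := hA1.bounded
  have hf := hXY.density_measurable
  have hf0 := hXY.density_nonneg
  set G : E d × E q → ℝ := fun p =>
    Real.exp ((inner ℝ u p.2 + v) * K (r⁻¹ • (x - p.1))) - 1 with hG
  have hXYm : AEMeasurable (fun ω => (X i ω, Y i ω)) P :=
    ((hXY.measurable_X i).prodMk (hXY.measurable_Y i)).aemeasurable
  have hGm : AEStronglyMeasurable G (P.map fun ω => (X i ω, Y i ω)) :=
    ((Real.measurable_exp.comp_aemeasurable
      (hXY.aemeasurable_summand hA1 u v hr i)).sub_const 1).aestronglyMeasurable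
  have hint := hA2.integrable_kernel hf0 hf (hA1.integrable_rescaled x hr)
    (fun z => hC _) measurable_id u v
  have hGint : Integrable G (P.map fun ω => (X i ω, Y i ω)) := by
    rw [hXY.law i, integrable_withDensity_iff_integrable_smul' hf.ennreal_ofReal
      (Eventually.of_forall fun _ => ENNReal.ofReal_lt_top)]
    refine hint.congr (Eventually.of_forall fun p => ?_)
    simp only [ENNReal.toReal_ofReal (hf0 _ _), smul_eq_mul, id, hG]
    ring
  have hGval : ∫ p, G p ∂(P.map fun ω => (X i ω, Y i ω)) = r ^ d * smoothedPsi K f x u v r := by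
    rw [← integral_rescaled_kernel hA1 hA2 hf0 hf u v hr, hXY.law i,
      integral_withDensity_eq_integral_toReal_smul hf.ennreal_ofReal
      (Eventually.of_forall fun _ => ENNReal.ofReal_lt_top)]
    congr 1 with p
    simp only [ENNReal.toReal_ofReal (hf0 _ _), smul_eq_mul, hG]
    ring
  have hcomp : Integrable (fun ω => G (X i ω, Y i ω)) P := hGint.comp_aemeasurable hXYm
  have heq : (fun ω => Real.exp ((inner ℝ u (Y i ω) + v) * K (r⁻¹ • (x - X i ω)))) =
      fun ω => 1 + G (X i ω, Y i ω) := by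
    ext ω; simp [hG]
  refine ⟨by rw [heq]; exact (integrable_const 1).add hcomp, ?_⟩
  simp only [mgf, one_mul]
  rw [heq, integral_add (integrable_const 1) hcomp, ← hGval, integral_map hXYm hGm]
  simp

lemma IsSample.mgf_pairEst [IsProbabilityMeasure P] (hXY : IsSample P X Y f)
    (hA1 : CondA1 K) (hA2 : CondA2 f x) {h : ℕ → ℝ} (hpos : ∀ n, 0 < h n) {n : ℕ}
    (hn : (n : ℝ) * h n ^ d ≠ 0) (l : WithLp 2 (E q × ℝ)) :
    mgf (fun ω => inner ℝ l (pairEst K h X Y x n ω)) P ((n : ℝ) * h n ^ d) =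
      (1 + h n ^ d * smoothedPsi K f x l.fst l.snd (h n)) ^ n := by
  set W : ℕ → Ω → ℝ := fun i ω => (inner ℝ l.fst (Y i ω) + l.snd) * K ((h n)⁻¹ • (x - X i ω))
  have hXYm : ∀ i, AEMeasurable (fun ω => (X i ω, Y i ω)) P := fun i =>
    ((hXY.measurable_X i).prodMk (hXY.measurable_Y i)).aemeasurable
  have hW := fun i => hXY.aemeasurable_summand (x := x) hA1 l.fst l.snd (hpos n) i
  have hind : iIndepFun W P := hXY.indep.comp₀ _ hXYm hW
  have h1 := hind.mgf_sum₀ (t := 1) (fun i => (hW i).comp_aemeasurable (hXYm i)) (Finset.range n)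
  rw [Finset.prod_congr rfl fun i _ =>
    (hXY.integrable_and_mgf_summand hA1 hA2 l.fst l.snd (hpos n) i).2, Finset.prod_const,
    Finset.card_range] at h1
  rw [← h1]
  simp only [mgf, speed_mul_inner_pairEst hn, one_mul, Finset.sum_apply, W]

theorem IsSample.hasScaledMgfLimit [IsProbabilityMeasure P] (hd : 1 ≤ d) (hXY : IsSample P X Y f)
    (hA1 : CondA1 K) (hA2 : CondA2 f x) {h : ℕ → ℝ} (hpos : ∀ n, 0 < h n)
    (hlim : Tendsto h atTop (𝓝 0))
    (hspeed : Tendsto (fun n : ℕ => (n : ℝ) * h n ^ d) atTop atTop) :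
    HasScaledMgfLimit P (fun n => (n : ℝ) * h n ^ d) (pairEst K h X Y x) (psiFun K f x) := by
  have hψ : ∀ l : WithLp 2 (E q × ℝ), Tendsto (fun n => smoothedPsi K f x l.fst l.snd (h n)) atTop
      (𝓝 (psiFun K f x l)) := fun l =>
    tendsto_smoothedPsi hA1 hA2 hXY.density_nonneg hXY.density_measurable _ _ hlim
  have ht : ∀ l : WithLp 2 (E q × ℝ), Tendsto
      (fun n => 1 + h n ^ d * smoothedPsi K f x l.fst l.snd (h n)) atTop (𝓝 1) := by
    intro l
    have := ((hlim.pow d).mul (hψ l)).const_add 1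
    -- Here `d ≥ 1` is needed for `h n ^ d → 0`.
    rwa [zero_pow (by lia), zero_mul, add_zero] at this
  have hpos' : ∀ l : WithLp 2 (E q × ℝ), ∀ᶠ n in atTop,
      0 < 1 + h n ^ d * smoothedPsi K f x l.fst l.snd (h n) := fun l =>
    (ht l).eventually (lt_mem_nhds one_pos)
  refine ⟨hspeed, fun l => ?_, fun l ε hε => ?_, fun l ε hε => ?_⟩
  · filter_upwards [hpos' l, hspeed.eventually_gt_atTop 0] with n h1 hn
    have h2 := hXY.mgf_pairEst hA1 hA2 hpos hn.ne' l
    by_contra hni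
    -- A non-integrable exponential would have moment generating function `0` by convention,
    -- contradicting the positive value just computed.
    rw [mgf_undef hni] at h2
    exact (pow_pos h1 n).ne h2
  · filter_upwards [hpos' l, hspeed.eventually_gt_atTop 0,
      (hψ l).eventually (gt_mem_nhds (lt_add_of_pos_right _ hε))] with n h1 hn h3
    rw [hXY.mgf_pairEst hA1 hA2 hpos hn.ne' l]
    calc _ ≤ Real.exp (h n ^ d * smoothedPsi K f x l.fst l.snd (h n)) ^ n := by
          gcongr
          linarith [Real.add_one_le_exp (h n ^ d * smoothedPsi K f x l.fst l.snd (h n))]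
      _ = Real.exp (n * h n ^ d * smoothedPsi K f x l.fst l.snd (h n)) := by
          rw [← Real.exp_nat_mul, mul_assoc]
      _ ≤ _ := by gcongr
  · have h4 : Tendsto (fun n => smoothedPsi K f x l.fst l.snd (h n) /
        (1 + h n ^ d * smoothedPsi K f x l.fst l.snd (h n))) atTop (𝓝 (psiFun K f x l)) := by
      rw [← div_one (psiFun K f x l)]
      exact (hψ l).div (ht l) one_ne_zero
    filter_upwards [hpos' l, hspeed.eventually_gt_atTop 0,
      h4.eventually (lt_mem_nhds (sub_lt_self _ hε))] with n h1 hn h3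
    rw [hXY.mgf_pairEst hA1 hA2 hpos hn.ne' l]
    set ψ := smoothedPsi K f x l.fst l.snd (h n)
    -- The inequality `log (1 + s) ≥ s / (1 + s)`; the denominator tends to `1`, so nothing is lost
    -- in the limit.
    have h5 : h n ^ d * ψ / (1 + h n ^ d * ψ) ≤ Real.log (1 + h n ^ d * ψ) := by
      refine le_trans (le_of_eq ?_) (Real.one_sub_inv_le_log_of_pos h1)
      field_simp
      ring
    calc Real.exp (n * h n ^ d * (psiFun K f x l - ε))
        ≤ Real.exp (n * h n ^ d * (ψ / (1 + h n ^ d * ψ))) := by gcongr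
      _ = Real.exp (h n ^ d * ψ / (1 + h n ^ d * ψ)) ^ n := by
          rw [← Real.exp_nat_mul]; ring_nf
      _ ≤ (1 + h n ^ d * ψ) ^ n := by
          gcongr
          rwa [← Real.le_log_iff_exp_le h1]

/-! ### Transfer from the pair to the quotient -/

lemma inv_mul_log_le {a c : ℝ} (ha : 0 < a) [IsFiniteMeasure P] {s : Set Ω}
    (hs : P.real s ≤ Real.exp (a * c)) :
    ((a⁻¹ : ℝ) : EReal) * ENNReal.log (P s) ≤ c := by
  have h1 : ENNReal.log (P s) ≤ ((a * c : ℝ) : EReal) := by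
    rw [← Real.log_exp (a * c), ← ENNReal.log_ofReal_of_pos (Real.exp_pos _)]
    refine ENNReal.log_monotone ?_
    rw [← ofReal_measureReal]
    exact ENNReal.ofReal_le_ofReal hs
  refine (mul_le_mul_of_nonneg_left h1 (by exact_mod_cast (inv_pos.2 ha).le)).trans_eq ?_
  rw [← EReal.coe_mul, inv_mul_cancel_left₀ ha.ne']

lemma le_inv_mul_log {a c : ℝ} (ha : 0 < a) [IsFiniteMeasure P] {s : Set Ω}
    (hs : Real.exp (a * c) ≤ P.real s) :
    (c : EReal) ≤ ((a⁻¹ : ℝ) : EReal) * ENNReal.log (P s) := by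
  have h1 : ((a * c : ℝ) : EReal) ≤ ENNReal.log (P s) := by
    rw [← Real.log_exp (a * c), ← ENNReal.log_ofReal_of_pos (Real.exp_pos _)]
    refine ENNReal.log_monotone ?_
    rw [← ofReal_measureReal (μ := P) (s := s)]
    exact ENNReal.ofReal_le_ofReal hs
  refine le_trans (le_of_eq ?_)
    (mul_le_mul_of_nonneg_left h1 (by exact_mod_cast (inv_pos.2 ha).le))
  rw [← EReal.coe_mul, inv_mul_cancel_left₀ ha.ne']

lemma inner_sub_psiFun (l w : WithLp 2 (E q × ℝ)) :
    inner ℝ l w - psiFun K f x l =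
      inner ℝ l.fst w.fst + l.snd * w.snd - Psi K f x l.fst l.snd := by
  rw [WithLp.prod_inner_apply, psiFun, mul_comm l.snd]
  rfl

/-- Lower bound of the large deviation principle for the estimator. -/
theorem IsSample.ldp_lower_bound [IsProbabilityMeasure P] (hd : 1 ≤ d) (hXY : IsSample P X Y f)
    (hA1 : CondA1 K) (hA2 : CondA2 f x) {h : ℕ → ℝ} (hpos : ∀ n, 0 < h n)
    (hlim : Tendsto h atTop (𝓝 0))
    (hspeed : Tendsto (fun n : ℕ => (n : ℝ) * h n ^ d) atTop atTop) {U : Set (E q)}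
    (hU : IsOpen U) :
    -(⨅ s ∈ U, rateJStar K f x s) ≤ liminf (scaledLogProb P K h X Y x U) atTop := by
  have H := hXY.hasScaledMgfLimit hd hA1 hA2 hpos hlim hspeed
  have hf := hXY.density_measurable
  have hf0 := hXY.density_nonneg
  refine EReal.neg_le_of_neg_le (le_iInf₂ fun s hs => le_iInf₂ fun t ht => ?_)
  refine EReal.le_of_forall_lt_iff_le.1 fun c' hc' => ?_
  obtain ⟨c, hc, hcc'⟩ := EReal.lt_iff_exists_real_btwn.1 hc'
  refine EReal.neg_le_of_neg_le ?_
  rw [← EReal.coe_neg]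
  set G : Set (WithLp 2 (E q × ℝ)) := {w | w.snd ≠ 0} ∩ (fun w => w.snd⁻¹ • w.fst) ⁻¹' U
  have hsnd : IsOpen {w : WithLp 2 (E q × ℝ) | w.snd ≠ 0} :=
    isOpen_ne_fun (by fun_prop) continuous_const
  have hG : IsOpen G := by
    refine ContinuousOn.isOpen_inter_preimage ?_ hsnd hU
    refine ContinuousOn.smul (ContinuousOn.inv₀ (by fun_prop) fun w hw => hw) (by fun_prop)
  have hw : WithLp.toLp 2 (t • s, t) ∈ G := ⟨ht, by simpa [smul_smul, ht] using hs⟩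
  have hle : ∀ l, inner ℝ l (WithLp.toLp 2 (t • s, t)) - psiFun K f x l ≤ c := by
    intro l
    rw [inner_sub_psiFun, ← EReal.coe_le_coe_iff]
    exact (le_iSup₂ (f := fun u v => ((inner ℝ u (t • s) + v * t - Psi K f x u v : ℝ) : EReal))
      l.fst l.snd).trans hc.le
  refine le_liminf_of_le (by isBoundedDefault) ?_
  filter_upwards [H.lower_bound (continuous_psiFun hA1 hA2 hf0 hf)
    (differentiableAt_psiFun_line hA1 hA2 hf0 hf) hle (EReal.coe_lt_coe_iff.1 hcc') hG hw,
    hspeed.eventually_gt_atTop 0] with n h1 hn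
  refine le_inv_mul_log hn (h1.trans (measureReal_mono fun ω hω => ?_))
  obtain ⟨h2, h3⟩ := hω
  have h2 : gEst K h X x n ω ≠ 0 := h2
  simp only [Set.mem_ofPred_eq, rEst, if_pos h2]
  exact h3

/-- Upper bound of the large deviation principle for the estimator. -/
theorem IsSample.ldp_upper_bound [IsProbabilityMeasure P] (hd : 1 ≤ d) (hXY : IsSample P X Y f)
    (hA1 : CondA1 K) (hA2 : CondA2 f x) (hC : CondC K f x) {h : ℕ → ℝ} (hpos : ∀ n, 0 < h n)
    (hlim : Tendsto h atTop (𝓝 0))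
    (hspeed : Tendsto (fun n : ℕ => (n : ℝ) * h n ^ d) atTop atTop) {V : Set (E q)}
    (hV : IsClosed V) :
    limsup (scaledLogProb P K h X Y x V) atTop ≤ -(⨅ s ∈ V, rateJ K f x s) := by
  have H := hXY.hasScaledMgfLimit hd hA1 hA2 hpos hlim hspeed
  refine EReal.le_neg_of_le_neg (EReal.ge_of_forall_gt_iff_ge.1 fun c' hc' => ?_)
  obtain ⟨c, hcc', hc⟩ := EReal.lt_iff_exists_real_btwn.1 hc'
  refine EReal.le_neg_of_le_neg ?_
  rw [← EReal.coe_neg]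
  refine limsup_le_of_le (by isBoundedDefault) ?_
  -- The empty set is separate because the hyperplane argument below needs some `s₀ ∈ V`.
  rcases V.eq_empty_or_nonempty with rfl | ⟨s₀, hs₀⟩
  · filter_upwards [hspeed.eventually_gt_atTop 0] with n hn
    exact inv_mul_log_le hn (by simpa using Real.exp_nonneg _)
  have hJ : ∀ s ∈ V, ∀ t, (c : EReal) < rateI K f x (t • s) t := fun s hs t =>
    hc.trans_le ((iInf₂_le s hs).trans (iInf_le _ t))
  -- Contains the whole hyperplane `g = 0`: this makes it closed, and it takes in the outcomes where
  -- `r_n` has its default value `0`.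
  set C : Set (WithLp 2 (E q × ℝ)) := {w | w.snd ≠ 0 → w.snd⁻¹ • w.fst ∈ V}
  have hCc : IsClosed C := by
    have hsnd : IsOpen {w : WithLp 2 (E q × ℝ) | w.snd ≠ 0} :=
      isOpen_ne_fun (by fun_prop) continuous_const
    have h1 : IsOpen ({w : WithLp 2 (E q × ℝ) | w.snd ≠ 0} ∩
        (fun w => w.snd⁻¹ • w.fst) ⁻¹' Vᶜ) := by
      refine ContinuousOn.isOpen_inter_preimage ?_ hsnd hV.isOpen_compl
      refine ContinuousOn.smul (ContinuousOn.inv₀ (by fun_prop) fun w hw => hw) (by fun_prop)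
    rw [← isOpen_compl_iff]
    convert h1 using 1
    ext w
    simp [C]
  have hcov : ∀ w ∈ C, ∃ l, c < inner ℝ l w - psiFun K f x l := by
    intro w hw
    have h1 : (c : EReal) < rateI K f x w.fst w.snd := by
      -- On the hyperplane, (C) bounds the rate below by its value at the origin, which is the point
      -- `t = 0` on the line of `s₀` and so has rate above `c`.
      by_cases h0 : w.snd = 0
      · have h2 := hJ s₀ hs₀ 0
        rw [zero_smul, ← hC] at h2
        rw [h0]
        exact h2.trans_le (iInf_le _ w.fst)
      · have h2 := hJ _ (hw h0) w.snd
        rwa [smul_smul, mul_inv_cancel₀ h0, one_smul] at h2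
    obtain ⟨u, h2⟩ := lt_iSup_iff.1 h1
    obtain ⟨v, h3⟩ := lt_iSup_iff.1 h2
    refine ⟨WithLp.toLp 2 (u, v), ?_⟩
    rw [inner_sub_psiFun]
    exact EReal.coe_lt_coe_iff.1 h3
  filter_upwards [H.upper_bound hCc hcov (EReal.coe_lt_coe_iff.1 hcc'),
    hspeed.eventually_gt_atTop 0] with n h1 hn
  refine inv_mul_log_le hn ((measureReal_mono fun ω hω => ?_).trans h1)
  intro h2
  have h2 : gEst K h X x n ω ≠ 0 := h2
  simp only [Set.mem_ofPred_eq, rEst, if_pos h2] at hω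
  exact hω

end NadarayaWatson

theorem theorem1 {Ω : Type*} [MeasurableSpace Ω] (P : Measure Ω) [IsProbabilityMeasure P]
    {d q : ℕ} (hd : 1 ≤ d)
    (X : ℕ → Ω → NadarayaWatson.E d) (Y : ℕ → Ω → NadarayaWatson.E q)
    (f : NadarayaWatson.E d → NadarayaWatson.E q → ℝ)
    (hXY : NadarayaWatson.IsSample P X Y f)
    (K : NadarayaWatson.E d → ℝ) (x : NadarayaWatson.E d)
    (hA1 : NadarayaWatson.CondA1 K)
    (hA2 : NadarayaWatson.CondA2 f x)
    (hC : NadarayaWatson.CondC K f x)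
    (h : ℕ → ℝ) (hpos : ∀ n, 0 < h n)
    (hlim : Tendsto h atTop (𝓝 0))
    (hspeed : Tendsto (fun n : ℕ => (n : ℝ) * h n ^ d) atTop atTop) :
    (∀ U : Set (NadarayaWatson.E q), IsOpen U →
      -(⨅ s ∈ U, NadarayaWatson.rateJStar K f x s) ≤
        liminf (NadarayaWatson.scaledLogProb P K h X Y x U) atTop) ∧
    (∀ V : Set (NadarayaWatson.E q), IsClosed V →
      limsup (NadarayaWatson.scaledLogProb P K h X Y x V) atTop ≤
        -(⨅ s ∈ V, NadarayaWatson.rateJ K f x s)) := by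
  exact ⟨fun U hU => hXY.ldp_lower_bound hd hA1 hA2 hpos hlim hspeed hU,
    fun V hV => hXY.ldp_upper_bound hd hA1 hA2 hC hpos hlim hspeed hV⟩
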